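/- Let $\mu$ be a probability measure on $\mathbb{R}^2$ having a density $f:\mathbb{R}^2\to[0,\infty)$ with respect to Lebesgue measure. For a line $L\subset\mathbb{R}^2$ let $f_L$ be the integral of $f$ along $L$ with respect to length, and for $r,\theta\in\mathbb{R}$ write $f_{r,\theta}=f_{L(r,\theta)}$, where $L(r,\theta)=\{\mathbf{x}\in\mathbb{R}^2:\mathbf{x}\cdot(\cos\theta,\sin\theta)=r\}$. Put $$\kappa(\mu)=\frac23\,\mathbb{E}\left(\frac{f_{L(\mathbf{X},\mathbf{Y})}}{|\mathbf{X}-\mathbf{Y}|}\right)\in[0,\infty],$$ where $\mathbf{X},\mathbf{Y}$ are independent with law $\mu$, $L(\mathbf{X},\mathbf{Y})$ is the straight line through $\mathbf{X}$ and $\mathbf{Y}$, and $|\cdot|$ is the Euclidean norm; this does not depend on the choice of the density $f$. Let $V(\mu)$ be the covariance matrix of $\mathbf{X}$ and $|V(\mu)|$ its determinant, with $|V(\mu)|=\infty$ if $\mathbb{E}(|\mathbf{X}|^2)=\infty$. Consider the conditions: (A1) there exists $M<\infty$ such that $f(\mathbf{x})\le M$ for all $\mathbf{x}\in\mathbb{R}^2$;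 (A2) there exists $N<\infty$ such that $f_{r,\theta}\le N$ for all $r,\theta$. (a) Assume that $\mu$ has a density satisfying (A1) and (A2). Then for every non-singular affine map $T:\mathbb{R}^2\to\mathbb{R}^2$, if $\tilde\mu$ denotes the law of $T(\mathbf{X})$, $$\kappa(\tilde\mu)\,|V(\tilde\mu)|^{1/2}=\kappa(\mu)\,|V(\mu)|^{1/2},\qquad\text{and}\qquad \kappa(\mu)\,|V(\mu)|^{1/2}\ge\frac1{6\pi}.$$ (b) Let $S\subseteq\mathbb{R}^2$ be a Lebesgue measurable set with Lebesgue measure $0<|S|<\infty$, and let $\mu$ be the uniform probability measure on $S$. Then $$\kappa(\mu)\le\frac{2}{|S|},$$ and equality holds if and only if $S$ is essentially convex, i.e. there is a Lebesgue null set $N\subseteq\mathbb{R}^2$ such that the symmetric difference $S\,\triangle\,N$ is convex. -/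

import Mathlib

open MeasureTheory ProbabilityTheory
open scoped ENNReal NNReal

noncomputable section

namespace SmallTriangles

/-- The Euclidean plane `ℝ²`, with the Euclidean norm and Lebesgue measure `volume`. -/
abbrev Plane : Type := EuclideanSpace ℝ (Fin 2)

/-- The unit vector `e^{iθ} = (cos θ, sin θ)`. -/
def unitVec (θ : ℝ) : Plane := !₂[Real.cos θ, Real.sin θ]

/-- The unit vector `i e^{iθ} = (-sin θ, cos θ)`. -/
def perpVec (θ : ℝ) : Plane := !₂[-Real.sin θ, Real.cos θ]

/-- For a unit vector `v`, the integral of `g` with respect to length along the line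
`{p + t v : t ∈ ℝ}`. -/
def lineIntegral (g : Plane → ℝ≥0∞) (p v : Plane) : ℝ≥0∞ :=
  ∫⁻ t : ℝ, g (p + t • v)

/-- `f_{r,θ}`: the integral of `g` along the line
`L(r,θ) = {r e^{iθ} + t i e^{iθ} : t ∈ ℝ}`. -/
def marginal (g : Plane → ℝ≥0∞) (r θ : ℝ) : ℝ≥0∞ :=
  lineIntegral g (r • unitVec θ) (perpVec θ)

/-- For `x ≠ y`, the integral of `g` along the straight line through `x` and `y`. -/
def integralThrough (g : Plane → ℝ≥0∞) (x y : Plane) : ℝ≥0∞ :=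
  lineIntegral g x (‖y - x‖⁻¹ • (y - x))

/-- The Borel function `f : ℝ² → [0,∞)` is a density of `μ` with respect to Lebesgue measure. -/
def IsDensity (μ : Measure Plane) (f : Plane → ℝ≥0) : Prop :=
  Measurable f ∧ μ = volume.withDensity (fun x => (f x : ℝ≥0∞))

/-- `f` is bounded. -/
def BoundedDensity (f : Plane → ℝ≥0) : Prop :=
  ∃ M : ℝ≥0, ∀ x, f x ≤ M

/-- The integrals of `f` along lines are uniformly bounded. -/
def BoundedMarginals (f : Plane → ℝ≥0) : Prop :=
  ∃ N : ℝ≥0, ∀ r θ : ℝ, marginal (fun x => (f x : ℝ≥0∞)) r θ ≤ N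

/-- `κ(μ) = (2/3) E (f_L / |X - Y|)`, where `X, Y` are independent with law `μ`, `L` is the line
through them, and `f` is the density of `μ` (the value does not depend on the version of the
density). It is an integral of a nonnegative function, with values in `[0,∞]`. -/
def kappa (μ : Measure Plane) : ℝ≥0∞ :=
  (2 / 3) * ∫⁻ p : Plane × Plane,
    integralThrough (μ.rnDeriv volume) p.1 p.2 / edist p.1 p.2 ∂(μ.prod μ)

/-- The covariance matrix `V(μ)` of a random vector with law `μ`
(used only if the second moment is finite). -/
def covMatrix (μ : Measure Plane) : Matrix (Fin 2) (Fin 2) ℝ :=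
  Matrix.of fun i j => cov[fun x : Plane => x i, fun x : Plane => x j; μ]

open Classical in
/-- `|V(μ)|`: the determinant of the covariance matrix, and `∞` if `E |X|² = ∞`. -/
def detCov (μ : Measure Plane) : ℝ≥0∞ :=
  if ∫⁻ x, ‖x‖ₑ ^ 2 ∂μ = ∞ then ∞ else ENNReal.ofReal (covMatrix μ).det

/-- `S` is essentially convex: for some Lebesgue null set `N`, the symmetric difference of `S`
and `N` is convex. -/
def EssentiallyConvex (S : Set Plane) : Prop :=
  ∃ N : Set Plane, volume N = 0 ∧ Convex ℝ (symmDiff S N)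

/-- The uniform probability measure on `S`, for `0 < |S| < ∞`. -/
def uniformMeasure (S : Set Plane) : Measure Plane :=
  (volume S)⁻¹ • volume.restrict S

end SmallTriangles

end

/-!
The triple integral behind both halves of the theorem comes from one remark: parametrizing the line
through `x` and `y` by `t ↦ x + t (y - x)` absorbs the factor `1 / |x - y|`, so that for a density
`h` of `μ`

  `κ(μ) = (2/3) ∫∫∫ h(x + t (y - x)) dt dμ(y) dμ(x)`  (`kappa_eq`).

*Affine invariance.* The points `x + t (y - x)` are transported by affine maps and the density of
the image of `μ` by `T` is `h ∘ T⁻¹ / |det T|`; hence `κ` is divided by `|det T|`, while `|V|` is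
multiplied by `(det T)²`.

*Lower bound.* In slope coordinates the triple integral is `∫∫ g_m(c)³ dc dm`, where `g_m` is the
density of `Y - m X` (`kappa_eq_lintegral_slopeMarginal`). Chebyshev's and Hölder's inequalities
give `∫ g_m³ ≥ 27 / (1024 σ_m²)` for the variance `σ_m²` of `Y - m X`. This variance is a quadratic
polynomial in `m` with discriminant `-4 |V|`, so that `∫ dm / σ_m² = π / |V|^(1/2)`, and
`(2/3) (27/1024) π ≥ 1 / (6π)`. If the second moment is infinite, it is enough that `κ(μ) > 0`.

*Uniform measures.* For the uniform measure on `S` the triple integral runs over collinear triples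
of points of `S`. Relabelling the points shows that each of the three is the middle one with the
same weight (`lintegral_pairMass`), so
`κ = 2 |S|⁻³ ∫₀¹ |{(x, y) ∈ S² : x + t (y - x) ∈ S}| dt ≤ 2 / |S|`.
Equality means that for almost every `t ∈ (0, 1)`, almost every pair of points of `S` is divided at
the ratio `t` by a point of `S`. This forces the set of Lebesgue density points of `S` to be convex
(`convex_densityPoints`): every point near a point dividing two density points is itself divided by
a positive measure of pairs of points of `S`. Conversely, a set almost equal to a convex set
satisfies the equality condition.
-/

noncomputable section

namespace SmallTriangles

/-! ### Homotheties and the parametrization of a line by two of its points -/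

section Homothety

variable {E : Type*} [NormedAddCommGroup E] [NormedSpace ℝ E] [FiniteDimensional ℝ E]
  [MeasurableSpace E] [BorelSpace E] (ν : Measure E) [ν.IsAddHaarMeasure]

theorem lintegral_comp_add_smul {F : E → ℝ≥0∞} (hF : Measurable F) (a : E) {c : ℝ} (hc : c ≠ 0) :
    ∫⁻ y, F (a + c • y) ∂ν =
      ENNReal.ofReal |(c ^ Module.finrank ℝ E)⁻¹| * ∫⁻ y, F y ∂ν := by
  have h1 : ∫⁻ y, F (a + c • y) ∂ν = ∫⁻ z, F (a + z) ∂(ν.map (c • ·)) := by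
    rw [lintegral_map (by fun_prop) (by fun_prop)]
  rw [h1, Measure.map_addHaar_smul ν hc, lintegral_smul_measure, lintegral_add_left_eq_self,
    smul_eq_mul]

theorem lintegral_comp_homothety {F : E → ℝ≥0∞} (hF : Measurable F) (x : E) {c : ℝ} (hc : c ≠ 0) :
    ∫⁻ y, F (x + c • (y - x)) ∂ν =
      ENNReal.ofReal |(c ^ Module.finrank ℝ E)⁻¹| * ∫⁻ y, F y ∂ν := by
  rw [← lintegral_comp_add_smul ν hF (x - c • x) hc]
  refine lintegral_congr fun y => ?_
  congr 1
  module

theorem quasiMeasurePreserving_homothety (x : E) {c : ℝ} (hc : c ≠ 0) :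
    Measure.QuasiMeasurePreserving (fun y => x + c • (y - x)) ν ν := by
  refine ⟨by fun_prop, Measure.AbsolutelyContinuous.mk fun s hs h0 => ?_⟩
  have h := lintegral_comp_homothety ν (measurable_const.indicator hs : Measurable
    (s.indicator fun _ => (1 : ℝ≥0∞))) x hc
  rw [Measure.map_apply (by fun_prop) hs]
  rw [lintegral_indicator_const hs, h0] at h
  simp only [mul_zero] at h
  rw [← lintegral_indicator_one (hs.preimage (by fun_prop))]
  exact h

end Homothety

theorem finrank_plane : Module.finrank ℝ Plane = 2 := by simp

theorem integralThrough_div_edist {g : Plane → ℝ≥0∞} (hg : Measurable g) {x y : Plane}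
    (hxy : x ≠ y) :
    integralThrough g x y / edist x y = ∫⁻ t : ℝ, g (x + t • (y - x)) := by
  have hd : 0 < ‖y - x‖ := norm_pos_iff.2 (sub_ne_zero.2 hxy.symm)
  have hE : edist x y = ENNReal.ofReal ‖y - x‖ := by
    rw [edist_comm, edist_eq_enorm_sub, ofReal_norm]
  have h := lintegral_comp_add_smul volume
    (F := fun t : ℝ => g (x + t • (y - x))) (by fun_prop) 0 (inv_ne_zero hd.ne')
  simp only [Module.finrank_self, pow_one, inv_inv, abs_of_pos hd] at h
  have h2 : integralThrough g x y = ENNReal.ofReal ‖y - x‖ * ∫⁻ t : ℝ, g (x + t • (y - x)) := by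
    rw [← h]
    unfold integralThrough lineIntegral
    refine lintegral_congr fun t => ?_
    rw [zero_add, smul_smul, smul_eq_mul, mul_comm]
  rw [h2, hE, mul_comm, ENNReal.mul_div_cancel_right (by simpa using hxy.symm.imp sub_eq_zero.1) (by simp)]

/-- `κ(μ)` as a triple integral over collinear triples `x`, `y`, `x + t (y - x)`. The parameter `t`
absorbs the factor `1 / |X - Y|`, and any measurable version `h` of the density may be used. -/
theorem kappa_eq {μ : Measure Plane} [IsFiniteMeasure μ] {h : Plane → ℝ≥0∞} (hh : Measurable h)
    (hμ : μ = volume.withDensity h) :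
    kappa μ = 2 / 3 * ∫⁻ x, ∫⁻ y, ∫⁻ t : ℝ, h (x + t • (y - x)) ∂volume ∂μ ∂μ := by
  have hac : μ ≪ volume := hμ ▸ withDensity_absolutelyContinuous _ _
  have hD : μ.rnDeriv volume =ᵐ[volume] h := by
    rw [hμ]; exact Measure.rnDeriv_withDensity _ hh
  have hm := Measure.measurable_rnDeriv μ volume
  have hna : NullSingletonClass μ := ⟨fun x => hac (measure_singleton x)⟩
  unfold kappa
  congr 1
  have hstep : ∀ x, ∀ᵐ y ∂μ, integralThrough (μ.rnDeriv volume) x y / edist x y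
      = ∫⁻ t : ℝ, h (x + t • (y - x)) := by
    intro x
    have h1 : ∀ᵐ y ∂(volume : Measure Plane), ∀ᵐ t : ℝ,
        μ.rnDeriv volume (x + t • (y - x)) = h (x + t • (y - x)) := by
      have hms : MeasurableSet {p : Plane × ℝ | μ.rnDeriv volume (x + p.2 • (p.1 - x))
          = h (x + p.2 • (p.1 - x))} :=
        measurableSet_eq_fun (by fun_prop) (by fun_prop)
      have h2 : ∀ᵐ t : ℝ, ∀ᵐ y ∂(volume : Measure Plane),
          μ.rnDeriv volume (x + t • (y - x)) = h (x + t • (y - x)) := by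
        filter_upwards [Measure.ae_ne volume (0 : ℝ)] with t ht
        exact (quasiMeasurePreserving_homothety volume x ht).ae hD
      exact (Measure.ae_ae_comm hms).2 h2
    have h3 : ∀ᵐ y ∂μ, y ≠ x := Measure.ae_ne μ x
    filter_upwards [hac.ae_le h1, h3] with y hy hne
    rw [integralThrough_div_edist hm hne.symm]
    exact lintegral_congr_ae hy
  have hmeas : Measurable fun p : Plane × Plane =>
      ∫⁻ t : ℝ, h (p.1 + t • (p.2 - p.1)) :=
    Measurable.lintegral_prod_right' (f := fun q : (Plane × Plane) × ℝ =>
      h (q.1.1 + q.2 • (q.1.2 - q.1.1))) (by fun_prop)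
  have hae : (fun p : Plane × Plane => integralThrough (μ.rnDeriv volume) p.1 p.2 / edist p.1 p.2)
      =ᵐ[μ.prod μ] fun p => ∫⁻ t : ℝ, h (p.1 + t • (p.2 - p.1)) := by
    have hm2 : Measurable fun p : Plane × Plane =>
        integralThrough (μ.rnDeriv volume) p.1 p.2 / edist p.1 p.2 := by
      unfold integralThrough lineIntegral
      refine Measurable.div ?_ (by fun_prop)
      exact Measurable.lintegral_prod_right' (f := fun q : (Plane × Plane) × ℝ =>
        μ.rnDeriv volume (q.1.1 + q.2 • ‖q.1.2 - q.1.1‖⁻¹ • (q.1.2 - q.1.1))) (by fun_prop)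
    refine (Measure.ae_prod_iff_ae_ae (measurableSet_eq_fun hm2 hmeas)).2 ?_
    exact Filter.Eventually.of_forall hstep
  rw [lintegral_congr_ae hae, lintegral_prod _ hmeas.aemeasurable]

/-! ### Affine maps -/

theorem measurable_affineEquiv (T : Plane ≃ᵃ[ℝ] Plane) : Measurable T :=
  (AffineMap.continuous_of_finiteDimensional T.toAffineMap).measurable

theorem affineEquiv_apply_eq (T : Plane ≃ᵃ[ℝ] Plane) (x : Plane) : T x = T.linear x + T 0 := by
  simpa using T.map_vadd (0 : Plane) x

theorem lintegral_comp_affineEquiv (T : Plane ≃ᵃ[ℝ] Plane) {F : Plane → ℝ≥0∞}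
    (hF : Measurable F) :
    ∫⁻ x, F (T x) = ENNReal.ofReal |(LinearMap.det (T.linear : Plane →ₗ[ℝ] Plane))⁻¹| *
      ∫⁻ x, F x := by
  have hdet : LinearMap.det (T.linear : Plane →ₗ[ℝ] Plane) ≠ 0 := T.linear.isUnit_det'.ne_zero
  have hL : Measurable (T.linear : Plane →ₗ[ℝ] Plane) :=
    (LinearMap.continuous_of_finiteDimensional _).measurable
  have h1 : ∫⁻ x, F (T x) =
      ∫⁻ z, F (z + T 0) ∂(Measure.map (T.linear : Plane →ₗ[ℝ] Plane) volume) := by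
    rw [lintegral_map (by fun_prop) hL]
    exact lintegral_congr fun x => by rw [affineEquiv_apply_eq]; rfl
  rw [h1, Measure.map_linearMap_addHaar_eq_smul_addHaar volume hdet, lintegral_smul_measure,
    lintegral_add_right_eq_self, smul_eq_mul]

theorem map_withDensity_affineEquiv (T : Plane ≃ᵃ[ℝ] Plane) {h : Plane → ℝ≥0∞}
    (hh : Measurable h) :
    (volume.withDensity h).map T = volume.withDensity fun x =>
      ENNReal.ofReal |(LinearMap.det (T.linear : Plane →ₗ[ℝ] Plane))⁻¹| * h (T.symm x) := by
  have hT := measurable_affineEquiv T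
  have hTs := measurable_affineEquiv T.symm
  ext A hA
  rw [Measure.map_apply hT hA, withDensity_apply _ (hT hA), withDensity_apply _ hA,
    lintegral_const_mul _ (by fun_prop), ← lintegral_indicator hA,
    ← lintegral_comp_affineEquiv T (by fun_prop (disch := exact hA)), ← lintegral_indicator (hT hA)]
  refine lintegral_congr fun x => ?_
  by_cases hx : T x ∈ A
  · simp [Set.indicator, hx]
  · simp [Set.indicator, hx]

theorem kappa_map_affineEquiv {μ : Measure Plane} [IsFiniteMeasure μ] {h : Plane → ℝ≥0∞}
    (hh : Measurable h) (hμ : μ = volume.withDensity h) (T : Plane ≃ᵃ[ℝ] Plane) :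
    kappa (μ.map T) =
      ENNReal.ofReal |(LinearMap.det (T.linear : Plane →ₗ[ℝ] Plane))⁻¹| * kappa μ := by
  have hT := measurable_affineEquiv T
  have hTs := measurable_affineEquiv T.symm
  have hmap := map_withDensity_affineEquiv T hh
  rw [← hμ] at hmap
  have hfin : IsFiniteMeasure (μ.map T) := Measure.isFiniteMeasure_map _ _
  set c := ENNReal.ofReal |(LinearMap.det (T.linear : Plane →ₗ[ℝ] Plane))⁻¹|
  have hmeas : Measurable fun p : Plane × Plane =>
      ∫⁻ t : ℝ, h (p.1 + t • (p.2 - p.1)) :=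
    Measurable.lintegral_prod_right' (f := fun q : (Plane × Plane) × ℝ =>
      h (q.1.1 + q.2 • (q.1.2 - q.1.1))) (by fun_prop)
  have hmeas' : Measurable fun p : Plane × Plane =>
      ∫⁻ t : ℝ, c * h (T.symm (p.1 + t • (p.2 - p.1))) :=
    Measurable.lintegral_prod_right' (f := fun q : (Plane × Plane) × ℝ =>
      c * h (T.symm (q.1.1 + q.2 • (q.1.2 - q.1.1)))) (by fun_prop)
  have hline : ∀ (x y : Plane) (t : ℝ), T.symm (T x + t • (T y - T x)) = x + t • (y - x) := by
    intro x y t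
    apply T.injective
    rw [T.apply_symm_apply, affineEquiv_apply_eq T (x + t • (y - x)), affineEquiv_apply_eq T x,
      affineEquiv_apply_eq T y]
    simp only [map_add, map_smul, map_sub]
    module
  rw [kappa_eq (by fun_prop) hmap, kappa_eq hh hμ, mul_left_comm]
  congr 1
  rw [lintegral_map hmeas'.lintegral_prod_right' hT, ← lintegral_const_mul _
    hmeas.lintegral_prod_right']
  refine lintegral_congr fun x => ?_
  have hmx : Measurable fun y => ∫⁻ t : ℝ, h (x + t • (y - x)) :=
    hmeas.comp measurable_prodMk_left
  have hmx' : Measurable fun y => ∫⁻ t : ℝ, c * h (T.symm (T x + t • (y - T x))) :=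
    hmeas'.comp measurable_prodMk_left
  dsimp only
  rw [lintegral_map hmx' hT, ← lintegral_const_mul _ hmx]
  refine lintegral_congr fun y => ?_
  simp only [hline]
  rw [lintegral_const_mul _ (by fun_prop)]

theorem memLp_id_two_iff {μ : Measure Plane} : MemLp id 2 μ ↔ ∫⁻ x, ‖x‖ₑ ^ 2 ∂μ ≠ ∞ := by
  rw [← lt_top_iff_ne_top, MemLp, and_iff_right (by fun_prop),
    eLpNorm_lt_top_iff_lintegral_rpow_enorm_lt_top (by norm_num) (by norm_num)]
  simp

theorem memLp_id_map_affineEquiv {μ : Measure Plane} [IsFiniteMeasure μ] (h : MemLp id 2 μ)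
    (T : Plane ≃ᵃ[ℝ] Plane) : MemLp id 2 (μ.map T) := by
  rw [memLp_map_measure_iff (by fun_prop) (measurable_affineEquiv T).aemeasurable]
  have := (h.continuousLinearMap_comp
    (LinearMap.toContinuousLinearMap (T.linear : Plane →ₗ[ℝ] Plane))).add (memLp_const (T 0))
  exact (memLp_congr_ae (ae_of_all _ fun x => (affineEquiv_apply_eq T x).symm)).1 this

theorem MemLp.coord {μ : Measure Plane} (h : MemLp id 2 μ) (i : Fin 2) :
    MemLp (fun x : Plane => x i) 2 μ :=
  h.continuousLinearMap_comp (EuclideanSpace.proj i : Plane →L[ℝ] ℝ)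

theorem covMatrix_map_affineEquiv {μ : Measure Plane} [IsProbabilityMeasure μ]
    (h : MemLp id 2 μ) (T : Plane ≃ᵃ[ℝ] Plane) :
    (covMatrix (μ.map T)).det =
      LinearMap.det (T.linear : Plane →ₗ[ℝ] Plane) ^ 2 * (covMatrix μ).det := by
  set b := (EuclideanSpace.basisFun (Fin 2) ℝ).toBasis
  set A := LinearMap.toMatrix b b (T.linear : Plane →ₗ[ℝ] Plane)
  have hA : A.det = LinearMap.det (T.linear : Plane →ₗ[ℝ] Plane) := LinearMap.det_toMatrix b _
  obtain ⟨v, hv⟩ : ∃ v : Plane, v = T 0 := ⟨_, rfl⟩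
  have hTi : ∀ (x : Plane) (i : Fin 2), T x i = ∑ j, A i j * x j + v i := by
    intro x i
    rw [hv]
    rw [affineEquiv_apply_eq T x]
    have := congrFun (LinearMap.toMatrix_mulVec_repr b b (T.linear : Plane →ₗ[ℝ] Plane) x) i
    simp only [b, Matrix.mulVec, dotProduct, OrthonormalBasis.coe_toBasis_repr_apply,
      EuclideanSpace.basisFun_repr] at this
    simp only [PiLp.add_apply, A, b]
    rw [this]; rfl
  have hcov : covMatrix (μ.map T) = A * covMatrix μ * A.transpose := by
    ext i j
    have hT := measurable_affineEquiv T
    have hm : ∀ i j, MemLp (fun x : Plane => A i j * x j) 2 μ :=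
      fun i j => (MemLp.coord h j).const_mul _
    have hs : ∀ i, MemLp (fun x : Plane => ∑ j, A i j * x j) 2 μ :=
      fun i => memLp_finsetSum _ fun j _ => hm i j
    rw [covMatrix, Matrix.of_apply, covariance_map_fun (by fun_prop) (by fun_prop) hT.aemeasurable]
    simp only [hTi]
    rw [covariance_add_const_left ((hs i).integrable (by norm_num)),
      covariance_add_const_right ((hs j).integrable (by norm_num)),
      covariance_fun_sum_fun_sum (hm i) (hm j)]
    have hc : ∀ k l, cov[fun x : Plane => A i k * x k, fun x : Plane => A j l * x l; μ] =
        A i k * (A j l * covMatrix μ k l) := fun k l => by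
      rw [covariance_const_mul_left, covariance_const_mul_right]; rfl
    rw [Finset.sum_congr rfl fun k _ => Finset.sum_congr rfl fun l _ => hc k l]
    generalize covMatrix μ = C
    simp only [Matrix.mul_apply, Matrix.transpose_apply, Fin.sum_univ_two]
    ring
  rw [hcov, Matrix.det_mul, Matrix.det_mul, Matrix.det_transpose, hA]
  ring

theorem detCov_map_affineEquiv {μ : Measure Plane} [IsProbabilityMeasure μ]
    (T : Plane ≃ᵃ[ℝ] Plane) :
    detCov (μ.map T) =
      ENNReal.ofReal |LinearMap.det (T.linear : Plane →ₗ[ℝ] Plane)| ^ 2 * detCov μ := by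
  have hT := measurable_affineEquiv T
  have hdet : LinearMap.det (T.linear : Plane →ₗ[ℝ] Plane) ≠ 0 := T.linear.isUnit_det'.ne_zero
  have hiff : MemLp id 2 (μ.map T) ↔ MemLp id 2 μ := by
    refine ⟨fun h => ?_, fun h => memLp_id_map_affineEquiv h T⟩
    have hfin : IsFiniteMeasure (μ.map T) := Measure.isFiniteMeasure_map _ _
    have := memLp_id_map_affineEquiv h T.symm
    rw [Measure.map_map (measurable_affineEquiv T.symm) hT] at this
    simpa [Function.comp_def] using this
  by_cases h : MemLp id 2 μ
  · rw [detCov, detCov, if_neg (memLp_id_two_iff.1 h), if_neg (memLp_id_two_iff.1 (hiff.2 h)),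
      covMatrix_map_affineEquiv h, ← ENNReal.ofReal_pow (abs_nonneg _), sq_abs,
      ENNReal.ofReal_mul (sq_nonneg _)]
  · rw [detCov, detCov, if_pos (not_not.1 (mt memLp_id_two_iff.2 h)),
      if_pos (not_not.1 (mt memLp_id_two_iff.2 (mt hiff.1 h))), ENNReal.mul_top]
    simpa using hdet

theorem kappa_mul_detCov_map_affineEquiv {μ : Measure Plane} [IsProbabilityMeasure μ]
    {h : Plane → ℝ≥0∞} (hh : Measurable h) (hμ : μ = volume.withDensity h)
    (T : Plane ≃ᵃ[ℝ] Plane) :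
    kappa (μ.map T) * detCov (μ.map T) ^ (1 / 2 : ℝ) = kappa μ * detCov μ ^ (1 / 2 : ℝ) := by
  have hdet : LinearMap.det (T.linear : Plane →ₗ[ℝ] Plane) ≠ 0 := T.linear.isUnit_det'.ne_zero
  rw [kappa_map_affineEquiv hh hμ, detCov_map_affineEquiv,
    ENNReal.mul_rpow_of_nonneg _ _ (by norm_num), ← ENNReal.rpow_natCast, ← ENNReal.rpow_mul]
  rw [mul_mul_mul_comm]
  have : ((2 : ℕ) : ℝ) * (1 / 2) = 1 := by norm_num
  rw [this, ENNReal.rpow_one, ← ENNReal.ofReal_mul (abs_nonneg _), ← abs_mul,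
    inv_mul_cancel₀ hdet]
  simp

/-! ### Cubes of the integrals along lines, in slope coordinates -/

theorem Measurable.planeMk {α : Type*} [MeasurableSpace α] {u v : α → ℝ} (hu : Measurable u)
    (hv : Measurable v) : Measurable fun a => (!₂[u a, v a] : Plane) :=
  (EuclideanSpace.volume_preserving_symm_measurableEquiv_toLp (Fin 2)).symm.measurable.comp
    ((MeasurableEquiv.finTwoArrow (α := ℝ)).symm.measurable.comp (hu.prodMk hv))

theorem lintegral_plane {F : Plane → ℝ≥0∞} (hF : Measurable F) :
    ∫⁻ p, F p = ∫⁻ x : ℝ, ∫⁻ y : ℝ, F !₂[x, y] := by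
  have h1 := (EuclideanSpace.volume_preserving_symm_measurableEquiv_toLp (Fin 2)).symm
  have h2 := (volume_preserving_finTwoArrow ℝ).symm
  have hF' : Measurable fun z => F ((MeasurableEquiv.toLp 2 (Fin 2 → ℝ)).symm.symm z) :=
    hF.comp h1.measurable
  rw [← h1.lintegral_comp hF, ← h2.lintegral_comp hF',
    Measure.volume_eq_prod, lintegral_prod _ (by
      exact (hF'.comp h2.measurable).aemeasurable)]
  rfl

theorem lintegral_eq_abs_mul {K : ℝ → ℝ≥0∞} (hK : Measurable K) (a : ℝ) {d : ℝ} (hd : d ≠ 0) :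
    ∫⁻ y, K y = ENNReal.ofReal |d| * ∫⁻ m, K (a + d * m) := by
  have h := lintegral_comp_add_smul volume hK a hd
  simp only [smul_eq_mul, Module.finrank_self, pow_one] at h
  rw [h, ← mul_assoc, ← ENNReal.ofReal_mul (abs_nonneg _), ← abs_mul, mul_inv_cancel₀ hd]
  simp

/-- The integral of `h` along the line `y = c + m x` with respect to the measure `dx`. As a function
of `c` it is the density of `Y - m X` when `(X, Y)` has density `h`. -/
def slopeMarginal (h : Plane → ℝ≥0∞) (m c : ℝ) : ℝ≥0∞ := ∫⁻ x : ℝ, h !₂[x, c + m * x]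

theorem Measurable.slopeMarginal {α : Type*} [MeasurableSpace α] {h : Plane → ℝ≥0∞}
    (hh : Measurable h) {u v : α → ℝ} (hu : Measurable u) (hv : Measurable v) :
    Measurable fun a => slopeMarginal h (u a) (v a) := by
  unfold SmallTriangles.slopeMarginal
  exact Measurable.lintegral_prod_right' (f := fun q : α × ℝ =>
    h !₂[q.2, v q.1 + u q.1 * q.2]) (hh.comp (Measurable.planeMk (by fun_prop) (by fun_prop)))

/-- The lines through a fixed point `(x₁, y₁)` are swept by the second point in two ways: by its
ordinate, or by the slope. The Jacobian `|x₂ - x₁|` of this change of variables cancels against the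
one of the passage from the parameter `t` to the abscissa of the third point. -/
theorem lintegral_ordinate_eq_lintegral_slope {h : Plane → ℝ≥0∞} (hh : Measurable h)
    {x₁ x₂ : ℝ} (y₁ : ℝ) (hx : x₂ ≠ x₁) :
    ∫⁻ y₂ : ℝ, h !₂[x₂, y₂] * ∫⁻ t : ℝ, h !₂[x₁ + t * (x₂ - x₁), y₁ + t * (y₂ - y₁)] =
      ∫⁻ m : ℝ, h !₂[x₂, y₁ + m * (x₂ - x₁)] * slopeMarginal h m (y₁ - m * x₁) := by
  have hd : x₂ - x₁ ≠ 0 := sub_ne_zero.2 hx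
  have hinner : Measurable fun y₂ : ℝ =>
      ∫⁻ t : ℝ, h !₂[x₁ + t * (x₂ - x₁), y₁ + t * (y₂ - y₁)] :=
    Measurable.lintegral_prod_right' (f := fun q : ℝ × ℝ =>
      h !₂[x₁ + q.2 * (x₂ - x₁), y₁ + q.2 * (q.1 - y₁)])
      (hh.comp (Measurable.planeMk (by fun_prop) (by fun_prop)))
  have hsec : Measurable fun y₂ : ℝ => h !₂[x₂, y₂] :=
    hh.comp (Measurable.planeMk (by fun_prop) (by fun_prop))
  have hprod : Measurable fun y₂ : ℝ =>
      h !₂[x₂, y₂] * ∫⁻ t : ℝ, h !₂[x₁ + t * (x₂ - x₁), y₁ + t * (y₂ - y₁)] := hsec.mul hinner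
  have hprod' : Measurable fun m : ℝ => h !₂[x₂, y₁ + (x₂ - x₁) * m] *
      ∫⁻ t : ℝ, h !₂[x₁ + t * (x₂ - x₁), y₁ + t * (y₁ + (x₂ - x₁) * m - y₁)] :=
    hprod.comp (f := fun m => y₁ + (x₂ - x₁) * m) (by fun_prop)
  rw [lintegral_eq_abs_mul hprod y₁ hd, ← lintegral_const_mul _ hprod']
  refine lintegral_congr fun m => ?_
  have hK : Measurable fun x₃ : ℝ => h !₂[x₃, y₁ - m * x₁ + m * x₃] :=
    hh.comp (Measurable.planeMk (by fun_prop) (by fun_prop))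
  rw [slopeMarginal, lintegral_eq_abs_mul hK x₁ hd, mul_left_comm]
  congr 2
  · simp only [mul_comm]
  · congr 1
    funext t
    congr 3
    · ring
    · congr 1; ring

theorem lintegral_collinear_eq {h : Plane → ℝ≥0∞} (hh : Measurable h) (p : Plane) :
    ∫⁻ q, h q * ∫⁻ t : ℝ, h (p + t • (q - p)) =
      ∫⁻ m : ℝ, slopeMarginal h m (p 1 - m * p 0) ^ 2 := by
  have hmeas : Measurable fun q : Plane => ∫⁻ t : ℝ, h (p + t • (q - p)) :=
    Measurable.lintegral_prod_right' (f := fun q : Plane × ℝ => h (p + q.2 • (q.1 - p)))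
      (by fun_prop)
  have hvec : ∀ x y t : ℝ, p + t • ((!₂[x, y] : Plane) - p) =
      !₂[p 0 + t * (x - p 0), p 1 + t * (y - p 1)] := by
    intro x y t
    ext i
    fin_cases i <;> simp
  have hbr : Measurable fun z : ℝ × ℝ =>
      h !₂[z.1, p 1 + z.2 * (z.1 - p 0)] * slopeMarginal h z.2 (p 1 - z.2 * p 0) :=
    (hh.comp (Measurable.planeMk (by fun_prop) (by fun_prop))).mul
      (Measurable.slopeMarginal hh (by fun_prop) (by fun_prop))
  rw [lintegral_plane (F := fun q => h q * ∫⁻ t : ℝ, h (p + t • (q - p))) (hh.mul hmeas)]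
  simp only [hvec]
  have hne : ∀ᵐ x₂ : ℝ, x₂ ≠ p 0 := Measure.ae_ne _ _
  rw [lintegral_congr_ae (hne.mono fun x₂ hx =>
    lintegral_ordinate_eq_lintegral_slope hh (p 1) hx)]
  rw [lintegral_lintegral_swap hbr.aemeasurable]
  refine lintegral_congr fun m => ?_
  have hsec : Measurable fun x : ℝ => h !₂[x, p 1 + m * (x - p 0)] :=
    hh.comp (Measurable.planeMk (by fun_prop) (by fun_prop))
  rw [lintegral_mul_const _ hsec, sq]
  congr 1
  unfold slopeMarginal
  refine lintegral_congr fun x => ?_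
  congr 3
  ring_nf

theorem lintegral_comp_sub_mul {h : Plane → ℝ≥0∞} (hh : Measurable h) {φ : ℝ → ℝ≥0∞}
    (hφ : Measurable φ) (m : ℝ) :
    ∫⁻ p, h p * φ (p 1 - m * p 0) = ∫⁻ c, slopeMarginal h m c * φ c := by
  have hm : Measurable fun z : ℝ × ℝ => h !₂[z.1, z.2 + m * z.1] * φ z.2 :=
    (hh.comp (Measurable.planeMk (by fun_prop) (by fun_prop))).mul (by fun_prop)
  rw [lintegral_plane (by fun_prop)]
  have h1 : ∀ x : ℝ, ∫⁻ y : ℝ, h !₂[x, y] * φ ((!₂[x, y] : Plane) 1 - m * (!₂[x, y] : Plane) 0) =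
      ∫⁻ c : ℝ, h !₂[x, c + m * x] * φ c := by
    intro x
    rw [← lintegral_add_right_eq_self _ (m * x)]
    refine lintegral_congr fun c => ?_
    congr 2
    simp
  simp only [h1]
  rw [lintegral_lintegral_swap hm.aemeasurable]
  refine lintegral_congr fun c => ?_
  have hsec : Measurable fun x : ℝ => h !₂[x, c + m * x] :=
    hh.comp (Measurable.planeMk (by fun_prop) (by fun_prop))
  rw [lintegral_mul_const _ hsec, slopeMarginal]

theorem kappa_eq_lintegral_slopeMarginal {μ : Measure Plane} [IsFiniteMeasure μ]
    {h : Plane → ℝ≥0∞} (hh : Measurable h) (hμ : μ = volume.withDensity h) :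
    kappa μ = 2 / 3 * ∫⁻ m : ℝ, ∫⁻ c : ℝ, slopeMarginal h m c ^ 3 := by
  have hmeas : Measurable fun p : Plane × Plane => ∫⁻ t : ℝ, h (p.1 + t • (p.2 - p.1)) :=
    Measurable.lintegral_prod_right' (f := fun q : (Plane × Plane) × ℝ =>
      h (q.1.1 + q.2 • (q.1.2 - q.1.1))) (by fun_prop)
  rw [kappa_eq hh hμ]
  congr 1
  have hcm : Measurable fun x => ∫⁻ y, ∫⁻ t : ℝ, h (x + t • (y - x)) ∂volume ∂μ :=
    hmeas.lintegral_prod_right'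
  have hq : Measurable fun z : Plane × ℝ => slopeMarginal h z.2 (z.1 1 - z.2 * z.1 0) :=
    Measurable.slopeMarginal hh (by fun_prop) (by fun_prop)
  conv_lhs => enter [1]; rw [hμ]
  rw [lintegral_withDensity_eq_lintegral_mul _ hh hcm]
  have h1 : ∀ x : Plane, (h * fun x => ∫⁻ y, ∫⁻ t : ℝ, h (x + t • (y - x)) ∂volume ∂μ) x =
      ∫⁻ m : ℝ, h x * slopeMarginal h m (x 1 - m * x 0) ^ 2 := by
    intro x
    have hx : Measurable fun y => ∫⁻ t : ℝ, h (x + t • (y - x)) :=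
      hmeas.comp measurable_prodMk_left
    rw [Pi.mul_apply, hμ, lintegral_withDensity_eq_lintegral_mul _ hh hx]
    have hqx : Measurable fun m : ℝ => slopeMarginal h m (x 1 - m * x 0) :=
      Measurable.slopeMarginal hh (by fun_prop) (by fun_prop)
    rw [lintegral_const_mul _ (hqx.pow_const 2),
      ← lintegral_collinear_eq hh x]
    rfl
  rw [lintegral_congr h1, lintegral_lintegral_swap
    (((hh.comp measurable_fst).mul (hq.pow_const 2)).aemeasurable)]
  refine lintegral_congr fun m => ?_
  rw [lintegral_comp_sub_mul hh (φ := fun c => slopeMarginal h m c ^ 2)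
    ((Measurable.slopeMarginal hh (by fun_prop) (by fun_prop)).pow_const 2) m]
  refine lintegral_congr fun c => ?_
  ring

/-! ### The lower bound -/

theorem setLIntegral_pow_three_le {α : Type*} [MeasurableSpace α] (ν : Measure α) {g : α → ℝ≥0∞}
    (hg : Measurable g) (I : Set α) :
    (∫⁻ c in I, g c ∂ν) ^ 3 ≤ (∫⁻ c, g c ^ 3 ∂ν) * ν I ^ 2 := by
  have hpq : (3 : ℝ).HolderConjugate (3 / 2) := by
    rw [Real.holderConjugate_iff]; norm_num
  have h := ENNReal.lintegral_mul_le_Lp_mul_Lq (ν.restrict I) hpq hg.aemeasurable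
    (aemeasurable_const (b := (1 : ℝ≥0∞)))
  simp only [Pi.mul_apply, mul_one, ENNReal.one_rpow, lintegral_const, one_mul,
    Measure.restrict_apply_univ] at h
  have h3 := pow_le_pow_left' h 3
  rw [mul_pow, ← ENNReal.rpow_natCast (_ ^ (1 / 3 : ℝ)), ← ENNReal.rpow_mul,
    ← ENNReal.rpow_natCast (ν I ^ _), ← ENNReal.rpow_mul] at h3
  norm_num at h3
  exact h3.trans (mul_le_mul_left (lintegral_mono' Measure.restrict_le_self le_rfl) _)

section Density

variable {μ : Measure Plane} {h : Plane → ℝ≥0∞}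

theorem measure_slope_preimage (hh : Measurable h) (hμ : μ = volume.withDensity h) (m : ℝ)
    {I : Set ℝ} (hI : MeasurableSet I) :
    μ {p | p 1 - m * p 0 ∈ I} = ∫⁻ c in I, slopeMarginal h m c := by
  have hpre : MeasurableSet {p : Plane | p 1 - m * p 0 ∈ I} :=
    (show Measurable fun p : Plane => p 1 - m * p 0 by fun_prop) hI
  have h1 := lintegral_comp_sub_mul hh (measurable_const.indicator hI :
    Measurable (I.indicator fun _ => (1 : ℝ≥0∞))) m
  rw [hμ, withDensity_apply _ hpre, ← lintegral_indicator hpre, ← lintegral_indicator hI]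
  convert h1 using 1
  · refine lintegral_congr fun p => ?_
    by_cases hp : p 1 - m * p 0 ∈ I <;> simp [Set.indicator, hp]
  · refine lintegral_congr fun c => ?_
    by_cases hc : c ∈ I <;> simp [Set.indicator, hc]

theorem lintegral_slopeMarginal (hh : Measurable h) (hμ : μ = volume.withDensity h) (m : ℝ) :
    ∫⁻ c, slopeMarginal h m c = μ Set.univ := by
  simpa using (measure_slope_preimage hh hμ m MeasurableSet.univ).symm

theorem kappa_ne_zero [IsProbabilityMeasure μ] (hh : Measurable h)
    (hμ : μ = volume.withDensity h) : kappa μ ≠ 0 := by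
  have hsm := Measurable.slopeMarginal hh measurable_fst (measurable_snd (α := ℝ) (β := ℝ))
  rw [kappa_eq_lintegral_slopeMarginal hh hμ]
  refine mul_ne_zero (by simp) fun h0 => ?_
  rw [lintegral_eq_zero_iff (hsm.pow_const 3).lintegral_prod_right'] at h0
  obtain ⟨m, hm⟩ := h0.exists
  have hmeas : Measurable (slopeMarginal h m) :=
    Measurable.slopeMarginal hh measurable_const measurable_id
  simp only [Pi.zero_apply] at hm
  rw [lintegral_eq_zero_iff (hmeas.pow_const 3)] at hm
  have h1 := lintegral_slopeMarginal hh hμ m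
  rw [measure_univ, (lintegral_eq_zero_iff hmeas).2 (hm.mono fun c hc => by simpa using hc)] at h1
  exact zero_ne_one h1

/-- By Chebyshev's inequality three quarters of the mass of the density of `Z = Y - m X` lie within
two standard deviations of the mean; Hölder's inequality on that interval bounds the integral of the
cube from below. -/
theorem le_lintegral_slopeMarginal_pow_three [IsProbabilityMeasure μ] (hh : Measurable h)
    (hμ : μ = volume.withDensity h) (h2 : MemLp id 2 μ) (m : ℝ)
    (hpos : 0 < Var[fun p : Plane => p 1 - m * p 0; μ]) :
    ENNReal.ofReal (27 / 1024 / Var[fun p : Plane => p 1 - m * p 0; μ]) ≤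
      ∫⁻ c, slopeMarginal h m c ^ 3 := by
  set Z : Plane → ℝ := fun p => p 1 - m * p 0
  have hZm : Measurable Z := by fun_prop
  have hZ : MemLp Z 2 μ := (MemLp.coord h2 1).sub ((MemLp.coord h2 0).const_mul m)
  set v := Var[Z; μ]
  have hs : 0 < √v := Real.sqrt_pos.2 hpos
  have hmeas : Measurable (slopeMarginal h m) :=
    Measurable.slopeMarginal hh measurable_const measurable_id
  have hch := meas_ge_le_variance_div_sq hZ (c := 2 * √v) (by positivity)
  rw [mul_pow, Real.sq_sqrt hpos.le, show v / (2 ^ 2 * v) = 1 / 4 by field_simp; norm_num] at hch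
  set I := Metric.ball (μ[Z]) (2 * √v)
  have hcompl : {p | Z p ∈ I}ᶜ = {p | 2 * √v ≤ |Z p - μ[Z]|} := by
    ext p
    simp [I, Real.dist_eq]
  have hI : MeasurableSet I := Metric.isOpen_ball.measurableSet
  have hmass : ENNReal.ofReal (3 / 4) ≤ ∫⁻ c in I, slopeMarginal h m c := by
    rw [← measure_slope_preimage hh hμ m hI]
    have hadd := measure_add_measure_compl (μ := μ) (hZm hI)
    change μ {p | Z p ∈ I} + μ {p | Z p ∈ I}ᶜ = _ at hadd
    rw [hcompl, measure_univ] at hadd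
    have h1 : ENNReal.ofReal (3 / 4) + ENNReal.ofReal (1 / 4) = 1 := by
      rw [← ENNReal.ofReal_add (by norm_num) (by norm_num)]; norm_num
    refine (ENNReal.add_le_add_iff_right (a := ENNReal.ofReal (1 / 4)) (by simp)).1 ?_
    rw [h1, ← hadd]
    gcongr
  have hH := (pow_le_pow_left' hmass 3).trans (setLIntegral_pow_three_le volume hmeas I)
  rw [Real.volume_ball, ← ENNReal.ofReal_pow (by positivity), ← ENNReal.ofReal_pow (by norm_num)]
    at hH
  have hc : (2 * (2 * √v)) ^ 2 = 16 * v := by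
    rw [mul_pow, mul_pow, Real.sq_sqrt hpos.le]; ring
  rw [hc] at hH
  have h16 : (0 : ℝ) < 16 * v := by positivity
  rw [← ENNReal.div_le_iff (by simpa using hpos) ENNReal.ofReal_ne_top, ← ENNReal.ofReal_div_of_pos h16] at hH
  refine le_trans (le_of_eq ?_) hH
  congr 1
  field_simp
  norm_num

theorem variance_slope_pos [IsProbabilityMeasure μ] (hh : Measurable h)
    (hμ : μ = volume.withDensity h) (h2 : MemLp id 2 μ) (m : ℝ) :
    0 < Var[fun p : Plane => p 1 - m * p 0; μ] := by
  refine (variance_nonneg _ _).lt_of_ne' fun h0 => ?_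
  have hae := ae_eq_integral_of_variance_eq_zero
    ((MemLp.coord h2 1).sub ((MemLp.coord h2 0).const_mul m)) h0
  set e := μ[fun p : Plane => p 1 - m * p 0]
  have hms : MeasurableSet {p : Plane | p 1 - m * p 0 = e} :=
    measurableSet_eq_fun (by fun_prop) measurable_const
  have h1 : μ {p : Plane | p 1 - m * p 0 = e} = 0 := by
    refine (measure_slope_preimage hh hμ m (measurableSet_singleton e)).trans ?_
    exact setLIntegral_measure_zero _ _ (by simp)
  have h3 : μ Set.univ = 0 := by
    rw [← measure_add_measure_compl hms, h1, zero_add]; exact hae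
  simp at h3

theorem variance_fst_pos [IsProbabilityMeasure μ] (hμ : μ = volume.withDensity h) (h2 : MemLp id 2 μ) :
    0 < Var[fun p : Plane => p 0; μ] := by
  refine (variance_nonneg _ _).lt_of_ne' fun h0 => ?_
  have hae := ae_eq_integral_of_variance_eq_zero (MemLp.coord h2 0) h0
  set e := μ[fun p : Plane => p 0]
  have hms : MeasurableSet {p : Plane | p 0 = e} :=
    measurableSet_eq_fun (by fun_prop) measurable_const
  have hnull : volume {p : Plane | p 0 = e} = 0 := by
    rw [← lintegral_indicator_one hms, lintegral_plane (measurable_one.indicator hms)]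
    rw [← lintegral_zero (μ := (volume : Measure ℝ))]
    refine lintegral_congr_ae ((Measure.ae_ne volume e).mono fun x hx => ?_)
    simp [Set.indicator, hx]
  have h1 : μ {p : Plane | p 0 = e} = 0 := hμ ▸ withDensity_absolutelyContinuous _ _ hnull
  have h3 : μ Set.univ = 0 := by
    rw [← measure_add_measure_compl hms, h1, zero_add]; exact hae
  simp at h3

end Density

/-- The substitution `m = b / a + (√D / a) u`, with `D = a c - b²`, reduces the integral to that of
`1 / (1 + u²)`. -/
theorem lintegral_inv_quadratic {a b c : ℝ} (ha : 0 < a) (hD : 0 < a * c - b ^ 2) {k : ℝ}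
    (hk : 0 ≤ k) :
    ∫⁻ m : ℝ, ENNReal.ofReal (k / (c - 2 * (m * b) + m ^ 2 * a)) =
      ENNReal.ofReal (k * Real.pi / √(a * c - b ^ 2)) := by
  set D := a * c - b ^ 2
  have hs : 0 < √D := Real.sqrt_pos.2 hD
  have hss : √D ^ 2 = D := Real.sq_sqrt hD.le
  have hd : √D / a ≠ 0 := by positivity
  rw [lintegral_eq_abs_mul (by fun_prop) (b / a) hd, abs_of_pos (by positivity)]
  have hint : ∀ u : ℝ, ENNReal.ofReal (k / (c - 2 * ((b / a + √D / a * u) * b) +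
      (b / a + √D / a * u) ^ 2 * a)) =
      ENNReal.ofReal (k * a / D) * ENNReal.ofReal ((1 + u ^ 2)⁻¹) := by
    intro u
    rw [← ENNReal.ofReal_mul (by positivity)]
    congr 1
    have h1 : c - 2 * ((b / a + √D / a * u) * b) + (b / a + √D / a * u) ^ 2 * a =
        D / a * (1 + u ^ 2) := by
      field_simp
      linear_combination u ^ 2 * hss
    rw [h1]
    have : 0 < 1 + u ^ 2 := by positivity
    field_simp
  simp only [hint]
  rw [lintegral_const_mul _ (by fun_prop), ← ofReal_integral_eq_lintegral_ofReal
    integrable_inv_one_add_sq (ae_of_all _ fun u => by positivity), integral_univ_inv_one_add_sq,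
    ← ENNReal.ofReal_mul (by positivity), ← ENNReal.ofReal_mul (by positivity)]
  congr 1
  field_simp
  linear_combination k * hss

theorem le_kappa_mul_detCov {μ : Measure Plane} [IsProbabilityMeasure μ] {h : Plane → ℝ≥0∞}
    (hh : Measurable h) (hμ : μ = volume.withDensity h) :
    ENNReal.ofReal (1 / (6 * Real.pi)) ≤ kappa μ * detCov μ ^ (1 / 2 : ℝ) := by
  by_cases h2 : MemLp id 2 μ
  swap
  -- `κ(μ) ≠ 0` excludes the product `0 * ∞ = 0`
  · rw [detCov, if_pos (not_not.1 (mt memLp_id_two_iff.2 h2)),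
      ENNReal.top_rpow_of_pos (by norm_num), ENNReal.mul_top (kappa_ne_zero hh hμ)]
    exact le_top
  set a := Var[fun p : Plane => p 0; μ] with ha_def
  set b := cov[fun p : Plane => p 0, fun p : Plane => p 1; μ] with hb_def
  set c := Var[fun p : Plane => p 1; μ] with hc_def
  have hvar : ∀ m : ℝ, Var[fun p : Plane => p 1 - m * p 0; μ] = c - 2 * (m * b) + m ^ 2 * a := by
    intro m
    rw [variance_fun_sub (MemLp.coord h2 1) ((MemLp.coord h2 0).const_mul m),
      covariance_const_mul_right, variance_const_mul, covariance_comm]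
  have ha : 0 < a := variance_fst_pos hμ h2
  have hD : 0 < a * c - b ^ 2 := by
    have h1 := variance_slope_pos hh hμ h2 (b / a)
    rw [hvar] at h1
    have h3 : c - 2 * (b / a * b) + (b / a) ^ 2 * a = (a * c - b ^ 2) / a := by
      field_simp; ring
    rw [h3] at h1
    exact (div_pos_iff_of_pos_right ha).1 h1
  have hdet : (covMatrix μ).det = a * c - b ^ 2 := by
    have h00 : covMatrix μ 0 0 = a := covariance_self (by fun_prop)
    have h11 : covMatrix μ 1 1 = c := covariance_self (by fun_prop)
    have h01 : covMatrix μ 0 1 = b := rfl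
    have h10 : covMatrix μ 1 0 = b := covariance_comm _ _
    rw [Matrix.det_fin_two, h00, h11, h01, h10, sq]
  have hs : 0 < √(a * c - b ^ 2) := Real.sqrt_pos.2 hD
  have hint : ENNReal.ofReal (27 / 1024 * Real.pi / √(a * c - b ^ 2)) ≤
      ∫⁻ m : ℝ, ∫⁻ c : ℝ, slopeMarginal h m c ^ 3 := by
    rw [← lintegral_inv_quadratic ha hD (by norm_num)]
    refine lintegral_mono fun m => ?_
    have hpos := variance_slope_pos hh hμ h2 m
    have := le_lintegral_slopeMarginal_pow_three hh hμ h2 m hpos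
    rwa [hvar] at this
  have h23 : (2 / 3 : ℝ≥0∞) = ENNReal.ofReal (2 / 3) := by
    rw [ENNReal.ofReal_div_of_pos (by norm_num)]; simp
  rw [detCov, if_neg (memLp_id_two_iff.1 h2), hdet, ENNReal.ofReal_rpow_of_pos hD,
    ← Real.sqrt_eq_rpow, kappa_eq_lintegral_slopeMarginal hh hμ, h23]
  calc ENNReal.ofReal (1 / (6 * Real.pi))
      ≤ ENNReal.ofReal (2 / 3 * (27 / 1024 * Real.pi / √(a * c - b ^ 2)) * √(a * c - b ^ 2)) := by
        refine ENNReal.ofReal_le_ofReal ?_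
        have hpi := Real.pi_gt_d2
        -- the constants compare because `256 / 27 < π²`
        rw [mul_assoc, div_mul_cancel₀ _ hs.ne', div_le_iff₀ (by positivity)]
        nlinarith
    _ = ENNReal.ofReal (2 / 3) * ENNReal.ofReal (27 / 1024 * Real.pi / √(a * c - b ^ 2)) *
        ENNReal.ofReal (√(a * c - b ^ 2)) := by
        rw [ENNReal.ofReal_mul (by positivity), ENNReal.ofReal_mul (by norm_num)]
    _ ≤ _ := by gcongr

/-! ### Collinear triples in a set -/

/-- The measure of the pairs `(x, y)` of points of `A` for which the point `x + t (y - x)` of the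
line through them belongs to `B`. -/
def pairMass (A B : Set Plane) (t : ℝ) : ℝ≥0∞ :=
  ∫⁻ x in A, ∫⁻ y in A, B.indicator 1 (x + t • (y - x))

section PairMass

variable {A B : Set Plane}

theorem measurable_pairMass_kernel (hB : MeasurableSet B) :
    Measurable fun q : (ℝ × Plane) × Plane =>
      B.indicator (1 : Plane → ℝ≥0∞) (q.1.2 + q.1.1 • (q.2 - q.1.2)) :=
  (measurable_one.indicator hB).comp (by fun_prop)

theorem measurable_pairMass (hB : MeasurableSet B) : Measurable (pairMass A B) :=
  (measurable_pairMass_kernel hB).lintegral_prod_right'.lintegral_prod_right'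

theorem measurable_indicator_line (hB : MeasurableSet B) (t : ℝ) :
    Measurable fun p : Plane × Plane => B.indicator (1 : Plane → ℝ≥0∞) (p.1 + t • (p.2 - p.1)) :=
  (measurable_one.indicator hB).comp (by fun_prop)

theorem measurable_indicator_line_snd (hB : MeasurableSet B) (t : ℝ) (x : Plane) :
    Measurable fun y : Plane => B.indicator (1 : Plane → ℝ≥0∞) (x + t • (y - x)) :=
  (measurable_one.indicator hB).comp (by fun_prop)

theorem pairMass_one_sub (hB : MeasurableSet B) (t : ℝ) :
    pairMass A B (1 - t) = pairMass A B t := by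
  unfold pairMass
  rw [lintegral_lintegral_swap (measurable_indicator_line hB _).aemeasurable]
  refine lintegral_congr fun x => lintegral_congr fun y => ?_
  congr 1
  module

theorem pairMass_eq_abs_mul (hA : MeasurableSet A) (hB : MeasurableSet B) {t : ℝ} (ht : t ≠ 0) :
    pairMass A B t = ENNReal.ofReal (t ^ 2)⁻¹ *
      ∫⁻ x in A, ∫⁻ z in B, A.indicator 1 (x + t⁻¹ • (z - x)) := by
  unfold pairMass
  rw [← lintegral_const_mul _ (measurable_indicator_line hA _).lintegral_prod_right']
  refine lintegral_congr fun x => ?_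
  have h := lintegral_comp_homothety volume (F := B.indicator fun z =>
    A.indicator (1 : Plane → ℝ≥0∞) (x + t⁻¹ • (z - x)))
    ((measurable_indicator_line_snd hA _ x).indicator hB) x ht
  rw [finrank_plane, abs_of_nonneg (by positivity), lintegral_indicator hB] at h
  rw [← h, ← lintegral_indicator hA]
  refine lintegral_congr fun y => ?_
  have hy : x + t⁻¹ • t • (y - x) = y := by rw [inv_smul_smul₀ ht]; module
  by_cases h1 : y ∈ A <;> by_cases h2 : x + t • (y - x) ∈ B <;> simp [Set.indicator, h1, h2, hy]

theorem pairMass_self_inv (hA : MeasurableSet A) {t : ℝ} (ht : t ≠ 0) :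
    pairMass A A t = ENNReal.ofReal (t ^ 2)⁻¹ * pairMass A A t⁻¹ :=
  pairMass_eq_abs_mul hA hA ht

theorem pairMass_add_compl (hB : MeasurableSet B) (t : ℝ) :
    pairMass A B t + pairMass A Bᶜ t = volume A ^ 2 := by
  unfold pairMass
  rw [← lintegral_add_left (measurable_indicator_line hB _).lintegral_prod_right']
  have h1 : ∀ x : Plane, (∫⁻ y in A, B.indicator (1 : Plane → ℝ≥0∞) (x + t • (y - x))) +
      ∫⁻ y in A, Bᶜ.indicator (1 : Plane → ℝ≥0∞) (x + t • (y - x)) = volume A := by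
    intro x
    rw [← lintegral_add_left (measurable_indicator_line_snd hB t x)]
    simp [Set.indicator_self_add_compl_apply]
  simp only [h1]
  rw [setLIntegral_const, sq]

theorem lintegral_Ioi_pairMass (hA : MeasurableSet A) :
    ∫⁻ t in Set.Ioi 1, pairMass A A t = ∫⁻ t in Set.Ioo 0 1, pairMass A A t := by
  have himg : (fun t : ℝ => t⁻¹) '' Set.Ioi 1 = Set.Ioo 0 1 := by
    ext u
    constructor
    · rintro ⟨t, ht, rfl⟩
      exact ⟨inv_pos.2 (zero_lt_one.trans ht), inv_lt_one_of_one_lt₀ ht⟩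
    · rintro ⟨h0, h1⟩
      exact ⟨u⁻¹, (one_lt_inv₀ h0).2 h1, inv_inv u⟩
  rw [← himg, lintegral_image_eq_lintegral_abs_deriv_mul measurableSet_Ioi
    (fun t ht => (hasDerivAt_inv (zero_lt_one.trans ht).ne').hasDerivWithinAt) inv_injective.injOn]
  refine setLIntegral_congr_fun measurableSet_Ioi fun t ht => ?_
  have ht0 : t ≠ 0 := (zero_lt_one.trans ht).ne'
  rw [abs_neg, abs_of_nonneg (by positivity), ← pairMass_self_inv hA ht0]

theorem lintegral_Iio_pairMass (hA : MeasurableSet A) :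
    ∫⁻ t in Set.Iio 0, pairMass A A t = ∫⁻ t in Set.Ioi 1, pairMass A A t := by
  rw [← lintegral_indicator measurableSet_Iio, ← lintegral_indicator measurableSet_Ioi,
    ← lintegral_sub_left_eq_self _ 1]
  refine lintegral_congr fun t => ?_
  by_cases ht : 1 < t
  · rw [Set.indicator_of_mem (by simpa using ht), Set.indicator_of_mem (by simpa using ht),
      pairMass_one_sub hA]
  · rw [Set.indicator_of_notMem (by simpa using ht), Set.indicator_of_notMem (by simpa using ht)]

/-- Among three collinear points, each is the middle one with the same weight: `t < 0`, `0 < t < 1`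
and `1 < t` are exchanged by relabelling the points. -/
theorem lintegral_pairMass (hA : MeasurableSet A) :
    ∫⁻ t, pairMass A A t = 3 * ∫⁻ t in Set.Ioo 0 1, pairMass A A t := by
  rw [← lintegral_add_compl _ (measurableSet_Iio (a := (0 : ℝ))), Set.compl_Iio,
    ← setLIntegral_congr (Ioi_ae_eq_Ici (a := (0 : ℝ))),
    ← Set.Ioc_union_Ioi_eq_Ioi (zero_le_one (α := ℝ)),
    lintegral_union measurableSet_Ioi (Set.Ioc_disjoint_Ioi le_rfl),
    ← setLIntegral_congr (Ioo_ae_eq_Ioc (a := (0 : ℝ)) (b := 1)),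
    lintegral_Iio_pairMass hA, lintegral_Ioi_pairMass hA]
  ring

theorem uniformMeasure_eq_withDensity (hA : MeasurableSet A) :
    uniformMeasure A = volume.withDensity fun x => (volume A)⁻¹ * A.indicator 1 x := by
  have : (fun x => (volume A)⁻¹ * A.indicator (1 : Plane → ℝ≥0∞) x) =
      (volume A)⁻¹ • A.indicator (1 : Plane → ℝ≥0∞) := rfl
  rw [this, withDensity_smul _ (measurable_one.indicator hA), withDensity_indicator_one hA]
  rfl

theorem isFiniteMeasure_uniformMeasure (h0 : 0 < volume A) (h1 : volume A < ∞) :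
    IsFiniteMeasure (uniformMeasure A) := by
  refine ⟨?_⟩
  rw [uniformMeasure, Measure.smul_apply, Measure.restrict_apply_univ, smul_eq_mul,
    ENNReal.inv_mul_cancel h0.ne' h1.ne]
  exact ENNReal.one_lt_top

theorem kappa_uniformMeasure (hA : MeasurableSet A) (h0 : 0 < volume A) (h1 : volume A < ∞) :
    kappa (uniformMeasure A) =
      2 / volume A ^ 3 * ∫⁻ t in Set.Ioo 0 1, pairMass A A t := by
  have := isFiniteMeasure_uniformMeasure h0 h1
  have hc0 : (volume A)⁻¹ ≠ ∞ := ENNReal.inv_ne_top.2 h0.ne'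
  have hswap : ∫⁻ x in A, ∫⁻ y in A, ∫⁻ t : ℝ, A.indicator (1 : Plane → ℝ≥0∞)
      (x + t • (y - x)) = ∫⁻ t, pairMass A A t := by
    unfold pairMass
    symm
    rw [lintegral_lintegral_swap
      (measurable_pairMass_kernel hA).lintegral_prod_right'.aemeasurable]
    refine lintegral_congr fun x => ?_
    have hk' : Measurable fun p : Plane × ℝ =>
        A.indicator (1 : Plane → ℝ≥0∞) (x + p.2 • (p.1 - x)) :=
      (measurable_one.indicator hA).comp (by fun_prop)
    exact (lintegral_lintegral_swap hk'.aemeasurable).symm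
  rw [kappa_eq (by exact (measurable_one.indicator hA).const_mul _)
    (uniformMeasure_eq_withDensity hA)]
  simp only [uniformMeasure, lintegral_smul_measure, smul_eq_mul]
  simp only [lintegral_const_mul' _ _ hc0]
  rw [hswap, lintegral_pairMass hA, ENNReal.div_eq_inv_mul, ENNReal.div_eq_inv_mul, ENNReal.inv_pow]
  generalize (∫⁻ t in Set.Ioo 0 1, pairMass A A t) = J
  have h3 : (3 : ℝ≥0∞)⁻¹ * 3 = 1 := ENNReal.inv_mul_cancel (by simp) (by simp)
  calc 3⁻¹ * 2 * ((volume A)⁻¹ * ((volume A)⁻¹ * ((volume A)⁻¹ * (3 * J))))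
      = (3⁻¹ * 3) * ((volume A)⁻¹ ^ 3 * 2 * J) := by ring
    _ = (volume A)⁻¹ ^ 3 * 2 * J := by rw [h3, one_mul]

theorem lintegral_pairMass_le (A : Set Plane) (hA : MeasurableSet A) :
    ∫⁻ t in Set.Ioo 0 1, pairMass A A t ≤ volume A ^ 2 := by
  calc ∫⁻ t in Set.Ioo 0 1, pairMass A A t ≤ ∫⁻ _ in Set.Ioo (0 : ℝ) 1, volume A ^ 2 :=
        lintegral_mono fun t => (pairMass_add_compl (A := A) hA t) ▸ le_self_add
    _ = volume A ^ 2 := by simp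

theorem two_div_pow_three_mul_sq {s : ℝ≥0∞} (h0 : 0 < s) (h1 : s < ∞) :
    2 / s ^ 3 * s ^ 2 = 2 / s := by
  rw [ENNReal.div_eq_inv_mul, ENNReal.div_eq_inv_mul, ENNReal.inv_pow]
  have h : s⁻¹ * s = 1 := ENNReal.inv_mul_cancel h0.ne' h1.ne
  calc s⁻¹ ^ 3 * 2 * s ^ 2 = s⁻¹ * 2 * (s⁻¹ * s) ^ 2 := by ring
    _ = s⁻¹ * 2 := by rw [h]; ring

theorem kappa_uniformMeasure_le (hA : MeasurableSet A) (h0 : 0 < volume A) (h1 : volume A < ∞) :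
    kappa (uniformMeasure A) ≤ 2 / volume A := by
  rw [kappa_uniformMeasure hA h0 h1, ← two_div_pow_three_mul_sq h0 h1]
  gcongr
  exact lintegral_pairMass_le A hA

theorem kappa_uniformMeasure_eq_iff (hA : MeasurableSet A) (h0 : 0 < volume A)
    (h1 : volume A < ∞) :
    kappa (uniformMeasure A) = 2 / volume A ↔
      ∀ᵐ t : ℝ, t ∈ Set.Ioo 0 1 → pairMass A Aᶜ t = 0 := by
  have hs2 : volume A ^ 2 ≠ ∞ := ENNReal.pow_ne_top h1.ne
  have hs3 : volume A ^ 3 ≠ ∞ := ENNReal.pow_ne_top h1.ne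
  rw [← ae_restrict_iff' measurableSet_Ioo, kappa_uniformMeasure hA h0 h1,
    ← two_div_pow_three_mul_sq h0 h1, ENNReal.mul_right_inj
    (ENNReal.div_ne_zero.2 ⟨by simp, hs3⟩)
    (ENNReal.div_ne_top (by simp) (pow_ne_zero 3 h0.ne'))]
  have hsum : (∫⁻ t in Set.Ioo 0 1, pairMass A A t) + ∫⁻ t in Set.Ioo 0 1, pairMass A Aᶜ t =
      volume A ^ 2 := by
    rw [← lintegral_add_left (measurable_pairMass hA)]
    simp [pairMass_add_compl hA]
  have hne : ∫⁻ t in Set.Ioo 0 1, pairMass A A t ≠ ∞ :=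
    ((lintegral_pairMass_le A hA).trans_lt hs2.lt_top).ne
  rw [← hsum]
  constructor
  · intro h
    have h2 : ∫⁻ t in Set.Ioo 0 1, pairMass A Aᶜ t = 0 := by
      have := (ENNReal.add_right_inj hne).1 ((add_zero _).trans h)
      exact this.symm
    exact (lintegral_eq_zero_iff (measurable_pairMass hA.compl)).1 h2
  · intro h
    have h2 : ∫⁻ t in Set.Ioo 0 1, pairMass A Aᶜ t = 0 :=
      (lintegral_eq_zero_iff (measurable_pairMass hA.compl)).2 h
    rw [h2, add_zero]

end PairMass

/-! ### The equality case: density points -/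

open Filter Topology Metric

/-- The points at which the complement of `S` has Lebesgue density `0`. -/
def densityPoints (S : Set Plane) : Set Plane :=
  {x | Tendsto (fun r => volume (Sᶜ ∩ closedBall x r) / volume (closedBall x r)) (𝓝[>] 0) (𝓝 0)}

theorem densityPoints_ae_eq {S : Set Plane} (hS : MeasurableSet S) :
    densityPoints S =ᵐ[volume] S := by
  filter_upwards [Besicovitch.ae_tendsto_measure_inter_div_of_measurableSet volume hS.compl]
    with x hx
  refine propext (Iff.intro (fun h => ?_) fun h => ?_)
  · by_contra hxS
    rw [Set.indicator_of_mem (show x ∈ Sᶜ from hxS)] at hx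
    exact zero_ne_one (tendsto_nhds_unique h hx)
  · rwa [Set.indicator_of_notMem (show x ∉ Sᶜ from not_not.2 h)] at hx

theorem mem_densityPoints_of_ball {S : Set Plane} {z : Plane} {ε : ℝ} (hε : 0 < ε)
    (h : volume (Sᶜ ∩ ball z ε) = 0) : z ∈ densityPoints S := by
  refine tendsto_const_nhds.congr' ?_
  filter_upwards [Ioo_mem_nhdsGT hε] with r hr
  rw [measure_mono_null (Set.inter_subset_inter_right _ (closedBall_subset_ball hr.2)) h,
    ENNReal.zero_div]

theorem exists_measure_compl_inter_le {S : Set Plane} {x : Plane} (hx : x ∈ densityPoints S) :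
    ∃ δ > 0, ∀ r, 0 < r → r < δ →
      volume (Sᶜ ∩ closedBall x r) ≤ ENNReal.ofReal (r ^ 2 / 16) * volume (ball (0 : Plane) 1) := by
  have h16 : (0 : ℝ≥0∞) < ENNReal.ofReal (1 / 16) := by simp
  obtain ⟨δ, hδ, h⟩ := (mem_nhdsGT_iff_exists_Ioo_subset).1 (hx.eventually (gt_mem_nhds h16))
  refine ⟨δ, hδ, fun r h0 hr => ?_⟩
  have h1 : volume (Sᶜ ∩ closedBall x r) / volume (closedBall x r) < ENNReal.ofReal (1 / 16) :=
    h ⟨h0, hr⟩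
  have h2 := (ENNReal.div_le_iff (measure_closedBall_pos volume x h0).ne'
    measure_closedBall_lt_top.ne).1 h1.le
  rw [Measure.addHaar_closedBall volume x h0.le, finrank_plane, ← mul_assoc,
    ← ENNReal.ofReal_mul (by norm_num)] at h2
  convert h2 using 3
  ring

/-- If almost every pair of points of `A` is divided at the ratio `t` by a point of `A`, then for
almost every point `w` outside `A` the pairs of points of `A` divided by `w` at this ratio form a
null set; such a pair is determined by its first point `x`, the second being
`x + t⁻¹ (w - x)`. -/
theorem ae_measure_eq_zero_of_pairMass_compl {A : Set Plane} (hA : MeasurableSet A) {t : ℝ}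
    (ht : t ≠ 0) (h : pairMass A Aᶜ t = 0) :
    ∀ᵐ w : Plane, w ∈ Aᶜ → volume (A ∩ {x | x + t⁻¹ • (w - x) ∈ A}) = 0 := by
  rw [pairMass_eq_abs_mul hA hA.compl ht, mul_eq_zero_iff_left (by simp; positivity),
    lintegral_lintegral_swap (measurable_indicator_line hA _).aemeasurable] at h
  have hm : Measurable fun w : Plane => ∫⁻ x in A, A.indicator (1 : Plane → ℝ≥0∞)
      (x + t⁻¹ • (w - x)) :=
    (measurable_indicator_line hA t⁻¹).lintegral_prod_left'
  rw [lintegral_eq_zero_iff hm] at h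
  refine ((ae_restrict_iff' hA.compl).1 h).mono fun w hw hwA => ?_
  have hset : MeasurableSet {x : Plane | x + t⁻¹ • (w - x) ∈ A} :=
    (show Measurable fun x : Plane => x + t⁻¹ • (w - x) by fun_prop) hA
  have h2 : ∫⁻ x in A, ({x : Plane | x + t⁻¹ • (w - x) ∈ A}).indicator 1 x = 0 := hw hwA
  rwa [lintegral_indicator_one hset, Measure.restrict_apply hset, Set.inter_comm] at h2

/-- Near the point dividing `x` and `y` at the ratio `t`, every point `w` divides a positive measure
of pairs of points of `S`, one near `x` and the other near `y`, at this ratio: the map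
`x' ↦ x' + t⁻¹ (w - x')` sends the ball of radius `r` about `x` into a ball about `y`, and the points
lost because they or their images lie outside `S` fill at most `1/16 + 1/4` of the ball. -/
theorem measure_inter_preimage_ne_zero {S : Set Plane} (hS : MeasurableSet S) {x y w : Plane}
    {t r : ℝ} (ht : t ∈ Set.Ioo (0 : ℝ) 1) (hr : 0 < r)
    (hx : volume (Sᶜ ∩ closedBall x r) ≤ ENNReal.ofReal (r ^ 2 / 16) * volume (ball (0 : Plane) 1))
    (hy : volume (Sᶜ ∩ closedBall y (2 * (t⁻¹ * (1 - t) * r))) ≤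
      ENNReal.ofReal ((2 * (t⁻¹ * (1 - t) * r)) ^ 2 / 16) * volume (ball (0 : Plane) 1))
    (hw : w ∈ ball (x + t • (y - x)) ((1 - t) * r)) :
    volume (S ∩ {x' | x' + t⁻¹ • (w - x') ∈ S}) ≠ 0 := by
  intro h0
  obtain ⟨ht0, ht1⟩ := ht
  have ht1' : 0 < 1 - t := sub_pos.2 ht1
  set ρ := t⁻¹ * (1 - t) * r
  set β := volume (ball (0 : Plane) 1)
  have hβ0 : β ≠ 0 := (measure_ball_pos volume _ one_pos).ne'
  have hβ1 : β ≠ ∞ := measure_ball_lt_top.ne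
  set φ : Plane → Plane := fun x' => x' + t⁻¹ • (w - x')
  have hc : 1 - t⁻¹ ≠ 0 := by
    have : (1 : ℝ) < t⁻¹ := (one_lt_inv₀ ht0).2 ht1
    linarith
  have hmaps : ∀ x' ∈ closedBall x r, φ x' ∈ closedBall y (2 * ρ) := by
    intro x' hx'
    rw [mem_closedBall, dist_eq_norm] at hx' ⊢
    rw [mem_ball, dist_eq_norm] at hw
    have h1 : φ x' - y = t⁻¹ • (w - (x + t • (y - x))) - (t⁻¹ * (1 - t)) • (x' - x) := by
      have h2 : t⁻¹ • (w - (x + t • (y - x))) = t⁻¹ • w - t⁻¹ • x - (y - x) := by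
        rw [sub_add_eq_sub_sub, smul_sub, smul_sub, inv_smul_smul₀ ht0.ne']
      have h3 : t⁻¹ * (1 - t) = t⁻¹ - 1 := by field_simp
      rw [h2, h3]
      simp only [φ]
      module
    rw [h1]
    refine (norm_sub_le _ _).trans ?_
    rw [norm_smul, norm_smul, Real.norm_of_nonneg (by positivity : 0 ≤ t⁻¹),
      Real.norm_of_nonneg (by positivity : 0 ≤ t⁻¹ * (1 - t))]
    have h4 : t⁻¹ * ‖w - (x + t • (y - x))‖ ≤ t⁻¹ * ((1 - t) * r) := by gcongr
    have h5 : t⁻¹ * (1 - t) * ‖x' - x‖ ≤ t⁻¹ * (1 - t) * r := by gcongr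
    simp only [ρ]
    linarith
  have hB : MeasurableSet (Sᶜ ∩ closedBall y (2 * ρ)) := hS.compl.inter measurableSet_closedBall
  have hφm : Measurable φ := by fun_prop
  have hvol : volume (φ ⁻¹' (Sᶜ ∩ closedBall y (2 * ρ))) ≤ ENNReal.ofReal (r ^ 2 / 4) * β := by
    have h1 := lintegral_comp_add_smul volume (F := (Sᶜ ∩ closedBall y (2 * ρ)).indicator 1)
      (measurable_one.indicator hB) (t⁻¹ • w) hc
    rw [lintegral_indicator_one hB, finrank_plane, abs_of_nonneg (by positivity)] at h1
    have h2 : ∫⁻ x', (Sᶜ ∩ closedBall y (2 * ρ)).indicator (1 : Plane → ℝ≥0∞)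
        (t⁻¹ • w + (1 - t⁻¹) • x') = volume (φ ⁻¹' (Sᶜ ∩ closedBall y (2 * ρ))) := by
      rw [← lintegral_indicator_one (hφm hB)]
      refine lintegral_congr fun x' => ?_
      have : φ x' = t⁻¹ • w + (1 - t⁻¹) • x' := by simp only [φ]; module
      rw [← this]
      rfl
    rw [← h2, h1]
    calc _ ≤ ENNReal.ofReal ((1 - t⁻¹) ^ 2)⁻¹ * (ENNReal.ofReal ((2 * ρ) ^ 2 / 16) * β) := by
          gcongr
      _ = ENNReal.ofReal (r ^ 2 / 4) * β := by
          rw [← mul_assoc, ← ENNReal.ofReal_mul (by positivity)]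
          congr 2
          have h3 : ρ = -((1 - t⁻¹) * r) := by
            simp only [ρ]; field_simp; ring
          rw [h3]
          generalize 1 - t⁻¹ = c at hc ⊢
          field_simp
          norm_num
  have hsub : closedBall x r ⊆ (Sᶜ ∩ closedBall x r) ∪
      (φ ⁻¹' (Sᶜ ∩ closedBall y (2 * ρ)) ∪ (S ∩ φ ⁻¹' S)) := by
    intro x' hx'
    by_cases h1 : x' ∈ S
    · by_cases h2 : φ x' ∈ S
      · exact Or.inr (Or.inr ⟨h1, h2⟩)
      · exact Or.inr (Or.inl ⟨h2, hmaps x' hx'⟩)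
    · exact Or.inl ⟨h1, hx'⟩
  have hle : ENNReal.ofReal (r ^ 2) * β ≤ ENNReal.ofReal (r ^ 2 / 16) * β +
      (ENNReal.ofReal (r ^ 2 / 4) * β + 0) := by
    have hball := Measure.addHaar_closedBall volume x hr.le
    rw [finrank_plane] at hball
    rw [← hball]
    refine (measure_mono hsub).trans ((measure_union_le _ _).trans ?_)
    gcongr
    refine (measure_union_le _ _).trans ?_
    gcongr
    exact h0.le
  rw [add_zero, ← add_mul, ENNReal.mul_le_mul_iff_left hβ0 hβ1,
    ← ENNReal.ofReal_add (by positivity) (by positivity),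
    ENNReal.ofReal_le_ofReal_iff (by positivity)] at hle
  nlinarith [sq_pos_of_pos hr]

/-- A point dividing two density points of `S` has a neighbourhood almost contained in `S`, and is
therefore a density point. -/
theorem convex_densityPoints {S : Set Plane} (hS : MeasurableSet S)
    (h : ∀ᵐ t : ℝ, t ∈ Set.Ioo 0 1 → pairMass S Sᶜ t = 0) : Convex ℝ (densityPoints S) := by
  rw [convex_iff_forall_pos]
  intro x hx y hy a t₀ ha ht₀ hsum
  have ht₁ : t₀ < 1 := by linarith
  have hz : a • x + t₀ • y = x + t₀ • (y - x) := by
    rw [show a = 1 - t₀ by linarith]; module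
  rw [hz]
  obtain ⟨δ, hδ, hxδ⟩ := exists_measure_compl_inter_le hx
  obtain ⟨δ', hδ', hyδ⟩ := exists_measure_compl_inter_le hy
  set r := min δ (t₀ * δ') / 4
  have hm : 0 < min δ (t₀ * δ') := lt_min hδ (mul_pos ht₀ hδ')
  have hr : 0 < r := by positivity
  have hr1 : r < δ := by
    have := min_le_left δ (t₀ * δ')
    simp only [r]; linarith
  have hr2 : 4 * r ≤ t₀ * δ' := by
    have := min_le_right δ (t₀ * δ')
    simp only [r]; linarith
  -- the hypothesis is only available for almost every ratio, so `t₀` is replaced by a nearby `t`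
  obtain ⟨t, htU, ht⟩ : ∃ t ∈ Set.Ioo t₀ 1 ∩ {t | (t - t₀) * ‖y - x‖ < (1 - t) * r / 2},
      t ∈ Set.Ioo (0 : ℝ) 1 → pairMass S Sᶜ t = 0 := by
    have hopen : IsOpen (Set.Ioo t₀ 1 ∩ {t | (t - t₀) * ‖y - x‖ < (1 - t) * r / 2}) :=
      isOpen_Ioo.inter (isOpen_lt (by fun_prop) (by fun_prop))
    have hne : (Set.Ioo t₀ 1 ∩ {t | (t - t₀) * ‖y - x‖ < (1 - t) * r / 2}).Nonempty := by
      have h1 : ∀ᶠ t in 𝓝 t₀, (t - t₀) * ‖y - x‖ < (1 - t) * r / 2 := by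
        refine (isOpen_lt (by fun_prop) (by fun_prop)).mem_nhds ?_
        rw [Set.mem_ofPred_eq, sub_self, zero_mul]
        have : 0 < 1 - t₀ := by linarith
        positivity
      have h2 := (h1.filter_mono nhdsWithin_le_nhds).and (Ioo_mem_nhdsGT ht₁)
      obtain ⟨t, h3, h4⟩ := h2.exists
      exact ⟨t, h4, h3⟩
    obtain ⟨t, h1, h2⟩ := (Measure.dense_of_ae h).inter_open_nonempty _ hopen hne
    exact ⟨t, h1, h2⟩
  obtain ⟨⟨htl, htr⟩, htn⟩ := htU
  rw [Set.mem_ofPred_eq] at htn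
  have ht0 : 0 < t := ht₀.trans htl
  have htr' : 0 < 1 - t := sub_pos.2 htr
  have hnull := ae_measure_eq_zero_of_pairMass_compl hS ht0.ne' (ht ⟨ht0, htr⟩)
  refine mem_densityPoints_of_ball (ε := (1 - t) * r / 2) (by positivity) ?_
  refine measure_mono_null ?_ (ae_iff.1 hnull)
  rintro w ⟨hwS, hw⟩
  rw [Set.mem_ofPred_eq, Classical.not_imp]
  refine ⟨hwS, measure_inter_preimage_ne_zero (x := x) (y := y) hS ⟨ht0, htr⟩ hr (hxδ r hr hr1)
    (hyδ _ (by positivity) ?_) ?_⟩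
  · have h1 : t⁻¹ * (1 - t) * r ≤ t₀⁻¹ * 1 * r := by
      gcongr
      linarith
    have h2 : t₀⁻¹ * (4 * r) ≤ δ' := by
      rw [inv_mul_le_iff₀ ht₀]; exact hr2
    have h3 : 0 < t₀⁻¹ * r := by positivity
    linarith
  · rw [mem_ball] at hw ⊢
    refine (dist_triangle _ (x + t₀ • (y - x)) _).trans_lt ?_
    have h1 : dist (x + t₀ • (y - x)) (x + t • (y - x)) = (t - t₀) * ‖y - x‖ := by
      rw [dist_add_left, dist_eq_norm, ← sub_smul, norm_smul, Real.norm_eq_abs, abs_sub_comm,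
        abs_of_pos (sub_pos.2 htl)]
    rw [h1]
    linarith

theorem pairMass_compl_eq_zero_of_convex {S K : Set Plane} (hS : MeasurableSet S)
    (hK : Convex ℝ K) (hSK : S =ᵐ[volume] K) {t : ℝ} (ht : t ∈ Set.Ioo (0 : ℝ) 1) :
    pairMass S Sᶜ t = 0 := by
  unfold pairMass
  have hmem : ∀ᵐ x ∂(volume.restrict S), x ∈ K := by
    filter_upwards [ae_restrict_mem hS, ae_restrict_of_ae hSK] with x hx h using h.mp hx
  rw [← lintegral_zero (μ := volume.restrict S)]
  refine lintegral_congr_ae (hmem.mono fun x hx => ?_)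
  have hq := quasiMeasurePreserving_homothety volume x ht.1.ne'
  simp only
  rw [← lintegral_zero (μ := volume.restrict S)]
  refine lintegral_congr_ae ?_
  filter_upwards [hmem, ae_restrict_of_ae (hq.ae hSK)] with y hy hxy
  have hzK : x + t • (y - x) ∈ K := by
    have := hK hx hy (sub_nonneg.2 ht.2.le) ht.1.le (by ring)
    convert this using 1
    module
  have hzS : x + t • (y - x) ∈ S := hxy.mpr hzK
  simp [hzS]

theorem essentiallyConvex_iff_exists_ae_eq {S : Set Plane} :
    EssentiallyConvex S ↔ ∃ K : Set Plane, Convex ℝ K ∧ S =ᵐ[volume] K := by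
  constructor
  · rintro ⟨N, hN, hc⟩
    refine ⟨_, hc, measure_symmDiff_eq_zero_iff.1 ?_⟩
    rwa [symmDiff_symmDiff_cancel_left]
  · rintro ⟨K, hK, h⟩
    refine ⟨symmDiff S K, measure_symmDiff_eq_zero_iff.2 h, ?_⟩
    rwa [symmDiff_symmDiff_cancel_left]

theorem kappa_uniformMeasure_eq_iff_essentiallyConvex {S : Set Plane} (hS : MeasurableSet S)
    (h0 : 0 < volume S) (h1 : volume S < ∞) :
    kappa (uniformMeasure S) = 2 / volume S ↔ EssentiallyConvex S := by
  rw [kappa_uniformMeasure_eq_iff hS h0 h1, essentiallyConvex_iff_exists_ae_eq]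
  constructor
  · exact fun h => ⟨_, convex_densityPoints hS h, (densityPoints_ae_eq hS).symm⟩
  · rintro ⟨K, hK, hSK⟩
    exact ae_of_all _ fun t ht => pairMass_compl_eq_zero_of_convex hS hK hSK ht

end SmallTriangles

end

theorem theorem2p3 :
    (∀ (μ : Measure SmallTriangles.Plane) [IsProbabilityMeasure μ]
        (f : SmallTriangles.Plane → ℝ≥0), SmallTriangles.IsDensity μ f →
        SmallTriangles.BoundedDensity f → SmallTriangles.BoundedMarginals f →
        (∀ T : SmallTriangles.Plane ≃ᵃ[ℝ] SmallTriangles.Plane,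
          SmallTriangles.kappa (μ.map T) * SmallTriangles.detCov (μ.map T) ^ (1 / 2 : ℝ) =
            SmallTriangles.kappa μ * SmallTriangles.detCov μ ^ (1 / 2 : ℝ)) ∧
        ENNReal.ofReal (1 / (6 * Real.pi)) ≤
          SmallTriangles.kappa μ * SmallTriangles.detCov μ ^ (1 / 2 : ℝ)) ∧
    (∀ S : Set SmallTriangles.Plane, NullMeasurableSet S volume →
        0 < volume S → volume S < ∞ →
        SmallTriangles.kappa (SmallTriangles.uniformMeasure S) ≤ 2 / volume S ∧
        (SmallTriangles.kappa (SmallTriangles.uniformMeasure S) = 2 / volume S ↔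
          SmallTriangles.EssentiallyConvex S)) := by
  refine ⟨fun μ _ f hf _ _ => ?_, fun S hS h0 h1 => ?_⟩
  · have hh : Measurable fun x => (f x : ℝ≥0∞) := hf.1.coe_nnreal_ennreal
    exact ⟨SmallTriangles.kappa_mul_detCov_map_affineEquiv hh hf.2,
      SmallTriangles.le_kappa_mul_detCov hh hf.2⟩
  · obtain ⟨A, hA, hSA⟩ := hS
    have hvol : volume S = volume A := measure_congr hSA
    have hunif : SmallTriangles.uniformMeasure S = SmallTriangles.uniformMeasure A := by
      rw [SmallTriangles.uniformMeasure, SmallTriangles.uniformMeasure, hvol,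
        Measure.restrict_congr_set hSA]
    have hconv : SmallTriangles.EssentiallyConvex S ↔ SmallTriangles.EssentiallyConvex A := by
      rw [SmallTriangles.essentiallyConvex_iff_exists_ae_eq,
        SmallTriangles.essentiallyConvex_iff_exists_ae_eq]
      exact exists_congr fun K => and_congr_right fun _ => ⟨hSA.symm.trans, hSA.trans⟩
    rw [hvol] at h0 h1
    rw [hunif, hvol, hconv]
    exact ⟨SmallTriangles.kappa_uniformMeasure_le hA h0 h1,
      SmallTriangles.kappa_uniformMeasure_eq_iff_essentiallyConvex hA h0 h1⟩
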